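/- Let $d\ge 1$ be an integer. For two points $x,y\in[0,1]^d$ define their toroidal distance by $$d_T(x,y)=\sqrt{\sum_{\ell=1}^d |x_\ell-y_\ell|_T^2},\qquad |t|_T=\min(|t|,\,1-|t|).$$ For $r\in[0,1]$ and a sequence $P=(p_1,\dots,p_n)$ of points of $[0,1]^d$, let $f_r(P)$ be the number of pairs of indices $i<j$ with $d_T(p_i,p_j)\le r$. Then for every exponent $a>0$ there is a constant $c_0>0$, depending only on $d$ and $a$, such that for every $c'\ge c_0$, every $n\ge 1$ and every $r\in[0,1]$ the following holds. If $p_1,\dots,p_n$ are independent random points, each uniformly distributed in $[0,1]^d$, and $f_r=f_r(p_1,\dots,p_n)$, then $$\Pr\bigl(|f_r-\mathbb{E}f_r|>c'\,n\log n\bigr)\le \frac1{n^{a}},$$ where $\log$ is the natural logarithm. Equivalently, with probability at least $1-n^{-a}$ the value $f_r$ lies in the interval $[\mathbb{E}f_r-c'n\log n,\ \mathbb{E}f_r+c'n\log n]$, whose length is $O(n\log n)$. -/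

import Mathlib

open MeasureTheory ProbabilityTheory

noncomputable section

/-- The toroidal length `|t|_T = min (|t|, 1 - |t|)` of a difference `t = x - y` of two numbers
`x, y ∈ [0,1]`. -/
def toroidalAbs (t : ℝ) : ℝ := min |t| (1 - |t|)

/-- The toroidal distance of two points of the cube `[0,1]^d`:
the square root of the sum of the squared toroidal lengths of the coordinate differences. -/
def toroidalDist {d : ℕ} (x y : Fin d → ℝ) : ℝ :=
  √(∑ l, toroidalAbs (x l - y l) ^ 2)

open Classical in
/-- `closePairs r p` is the number `f_r(p)` of pairs of indices `i < j` such that the points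
`p i` and `p j` of the sequence `p` are at toroidal distance at most `r`. -/
def closePairs {d n : ℕ} (r : ℝ) (p : Fin n → Fin d → ℝ) : ℕ :=
  (Finset.univ.filter fun q : Fin n × Fin n =>
    q.1 < q.2 ∧ toroidalDist (p q.1) (p q.2) ≤ r).card

end

/-! Gluing opposite faces of the cube turns `toroidalDist` into a translation-invariant distance on
a compact group. All balls of radius r then have the same volume, so the centred pair indicator
`closeKernel` integrates to zero in each variable separately. Hence f_r minus its mean is a
degenerate U-statistic of order two: it has no linear part, and its natural scale is n rather than
n^(3/2).

Its exponential moment at scale 4n is bounded by a constant (`lintegral_exp_sum_lt_le`). Averaging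
over all vertex subsets A reduces the sum over pairs to sums between A and its complement. With the
points in A fixed, the remaining points contribute independent centred terms, and their exponential
moment is controlled by the average over z of S(z)^2 / (4n), where S(z) sums the kernel between z
and the points of A. For fixed z, S(z) is sub-Gaussian with proxy n, so `lintegral_exp_sq_sum_le`
applies. Markov's inequality gives a tail of order exp(-t) at 4nt; taking t of order log n finishes.
-/

/-! ### Exponential moments of one variable. -/

theorem lintegral_exp_le_exp_integral_sq {X : Type*} [MeasurableSpace X] {ν : Measure X}
    [IsProbabilityMeasure ν] {φ : X → ℝ} (hm : Measurable φ) (hb : ∀ x, |φ x| ≤ 1)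
    (h0 : ∫ x, φ x ∂ν = 0) :
    ∫⁻ x, ENNReal.ofReal (Real.exp (φ x)) ∂ν ≤
      ENNReal.ofReal (Real.exp (∫ x, φ x ^ 2 ∂ν)) := by
  have hi : Integrable φ ν :=
    Integrable.of_bound hm.aestronglyMeasurable 1 (ae_of_all _ hb)
  have hi2 : Integrable (fun x => φ x ^ 2) ν :=
    Integrable.of_bound (hm.pow_const 2).aestronglyMeasurable 1 (ae_of_all _ fun x => by
      simpa [Real.norm_eq_abs] using hb x)
  have hie : Integrable (fun x => Real.exp (φ x)) ν :=
    Integrable.of_bound (Real.measurable_exp.comp hm).aestronglyMeasurable (Real.exp 1)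
      (ae_of_all _ fun x => by
        simpa [Real.norm_eq_abs] using (abs_le.1 (hb x)).2)
  rw [← ofReal_integral_eq_lintegral_ofReal hie (ae_of_all _ fun x => (Real.exp_pos _).le)]
  refine ENNReal.ofReal_le_ofReal ?_
  calc ∫ x, Real.exp (φ x) ∂ν ≤ ∫ x, (1 + φ x + φ x ^ 2) ∂ν := by
        refine integral_mono hie (((integrable_const 1).add hi).add hi2) fun x => ?_
        -- Uses exp t ≤ 1 + t + t^2 for |t| ≤ 1; the linear term integrates to zero.
        have := (abs_le.1 (Real.abs_exp_sub_one_sub_id_le (hb x))).2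
        dsimp only
        linarith
    _ = ∫ x, φ x ^ 2 ∂ν + 1 := by
        rw [integral_add (f := fun x => 1 + φ x) ((integrable_const 1).add hi) hi2,
          integral_add (integrable_const 1) hi, h0]
        simp [add_comm]
    _ ≤ _ := Real.add_one_le_exp _

theorem ofReal_exp_integral_le_lintegral {X : Type*} [MeasurableSpace X] {ν : Measure X}
    [IsProbabilityMeasure ν] {φ : X → ℝ} (hm : Measurable φ) {B : ℝ} (hb : ∀ x, |φ x| ≤ B) :
    ENNReal.ofReal (Real.exp (∫ x, φ x ∂ν)) ≤ ∫⁻ x, ENNReal.ofReal (Real.exp (φ x)) ∂ν := by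
  have hi : Integrable φ ν :=
    Integrable.of_bound hm.aestronglyMeasurable B (ae_of_all _ hb)
  have hie : Integrable (fun x => Real.exp (φ x)) ν :=
    Integrable.of_bound (Real.measurable_exp.comp hm).aestronglyMeasurable (Real.exp B)
      (ae_of_all _ fun x => by
        simpa [Real.norm_eq_abs] using (abs_le.1 (hb x)).2)
  rw [← ofReal_integral_eq_lintegral_ofReal hie (ae_of_all _ fun x => (Real.exp_pos _).le)]
  exact ENNReal.ofReal_le_ofReal (convexOn_exp.map_integral_le Real.continuous_exp.continuousOn
    isClosed_univ (ae_of_all _ fun _ => Set.mem_univ _) hi hie)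

/-- The value at which the exponential moment of the normalised square of a sub-Gaussian variable,
and that of a normalised degenerate U-statistic, are bounded. -/
noncomputable def expMomentBound : ℝ := 2 * Real.exp 1 * (1 - Real.exp (-1))⁻¹

theorem expMomentBound_pos : 0 < expMomentBound := by
  have : Real.exp (-1) < 1 := by simp
  have : 0 < 1 - Real.exp (-1) := by linarith
  unfold expMomentBound
  positivity

/-- Slicing by the integer part k of X^2 / (4c), the level k has probability at most 2 exp(-2k) and
the integrand there is at most exp(k + 1), which leaves a geometric series of ratio exp(-1). -/
theorem ProbabilityTheory.HasSubgaussianMGF.lintegral_exp_sq_le {Ω : Type*} [MeasurableSpace Ω]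
    {μ : Measure Ω} [IsProbabilityMeasure μ]
    {X : Ω → ℝ} {c : NNReal} (hc : 0 < c) (h : HasSubgaussianMGF X c μ)
    (hX : Measurable X) :
    ∫⁻ ω, ENNReal.ofReal (Real.exp (X ω ^ 2 / (4 * c))) ∂μ ≤ ENNReal.ofReal expMomentBound := by
  have hc' : (0 : ℝ) < c := hc
  have tail (k : ℕ) : μ {ω | (k : ℝ) ≤ X ω ^ 2 / (4 * c)} ≤
      ENNReal.ofReal (2 * Real.exp (-(2 * k))) := by
    have key (Y : Ω → ℝ) (hY : HasSubgaussianMGF Y c μ) :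
        μ.real {ω | 2 * √(c * k) ≤ Y ω} ≤ Real.exp (-(2 * k)) := by
      refine (hY.measure_ge_le (by positivity)).trans_eq ?_
      rw [neg_div, mul_pow, Real.sq_sqrt (by positivity)]
      congr 2
      field_simp
    have hsub : {ω | (k : ℝ) ≤ X ω ^ 2 / (4 * c)} ⊆
        {ω | 2 * √(c * k) ≤ X ω} ∪ {ω | 2 * √(c * k) ≤ (-X) ω} := by
      intro ω hω
      simp only [Set.mem_ofPred_eq, Set.mem_union, Pi.neg_apply] at hω ⊢
      rw [← le_abs]
      refine abs_le_of_sq_le_sq' ?_ (abs_nonneg _) |>.2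
      rw [sq_abs, mul_pow, Real.sq_sqrt (by positivity)]
      rw [le_div_iff₀ (by positivity)] at hω
      linarith
    rw [← ofReal_measureReal]
    refine ENNReal.ofReal_le_ofReal ?_
    calc _ ≤ _ := measureReal_mono hsub
      _ ≤ _ := measureReal_union_le _ _
      _ ≤ _ := by linarith [key X h, key (-X) h.neg]
  have hmeas (k : ℕ) : MeasurableSet {ω | (k : ℝ) ≤ X ω ^ 2 / (4 * c)} :=
    measurableSet_le measurable_const ((hX.pow_const 2).div_const _)
  calc ∫⁻ ω, ENNReal.ofReal (Real.exp (X ω ^ 2 / (4 * c))) ∂μ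
      ≤ ∫⁻ ω, ∑' k : ℕ, {ω | (k : ℝ) ≤ X ω ^ 2 / (4 * c)}.indicator
          (fun _ => ENNReal.ofReal (Real.exp (k + 1))) ω ∂μ := by
        refine lintegral_mono fun ω => ?_
        refine le_trans ?_ (ENNReal.le_tsum ⌊X ω ^ 2 / (4 * c)⌋₊)
        rw [Set.indicator_of_mem]
        · exact ENNReal.ofReal_le_ofReal (Real.exp_le_exp.2 (Nat.lt_floor_add_one _).le)
        · exact Nat.floor_le (a := X ω ^ 2 / (4 * c)) (by positivity)
    _ = ∑' k : ℕ, ENNReal.ofReal (Real.exp (k + 1)) * μ {ω | (k : ℝ) ≤ X ω ^ 2 / (4 * c)} := by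
        rw [lintegral_tsum fun k => (measurable_const.indicator (hmeas k)).aemeasurable]
        simp_rw [lintegral_indicator_const (hmeas _)]
    _ ≤ ∑' k : ℕ, ENNReal.ofReal (2 * Real.exp 1 * Real.exp (-1) ^ k) := by
        refine ENNReal.tsum_le_tsum fun k => ?_
        refine (mul_le_mul_right (tail k) _).trans_eq ?_
        rw [← ENNReal.ofReal_mul (Real.exp_pos _).le, ← Real.exp_nat_mul, mul_assoc,
          ← Real.exp_add, mul_left_comm, ← Real.exp_add]
        congr 3
        ring
    _ = ENNReal.ofReal expMomentBound := by
        have h1 : Real.exp (-1) < 1 := by simp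
        have hs := (hasSum_geometric_of_lt_one (Real.exp_pos (-1)).le h1).mul_left (2 * Real.exp 1)
        rw [expMomentBound, ← hs.tsum_eq,
          ENNReal.ofReal_tsum_of_nonneg (fun k => by positivity) hs.summable]

/-! ### Product measures. -/

theorem Measurable.comp_eval_eval {ι X : Type*} [MeasurableSpace X] {g : X → X → ℝ}
    (hg : Measurable (Function.uncurry g)) (i j : ι) :
    Measurable fun x : ι → X => g (x i) (x j) :=
  hg.comp (f := fun x : ι → X => (x i, x j))
    ((measurable_pi_apply i).prodMk (measurable_pi_apply j))

theorem lintegral_pi_prod_eq_prod {ι X : Type*} [Fintype ι] [MeasurableSpace X] {ν : Measure X}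
    [IsProbabilityMeasure ν] {F : ι → X → ENNReal} (hF : ∀ i, Measurable (F i)) :
    ∫⁻ x, ∏ i, F i (x i) ∂(Measure.pi fun _ : ι => ν) = ∏ i, ∫⁻ x, F i x ∂ν := by
  rw [lintegral_prod_eq_prod_lintegral_of_indepFun Finset.univ (fun i (x : ι → X) => F i (x i))
    (iIndepFun_pi fun i => (hF i).aemeasurable) (fun i => (hF i).comp (measurable_pi_apply i))]
  exact Finset.prod_congr rfl fun i _ =>
    (measurePreserving_eval (fun _ : ι => ν) i).lintegral_comp (hF i)

/-- Replaces conditioning on the coordinates in A: those outside A come from an independent copy, so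
Fubini applies. -/
theorem measurePreserving_piecewise {ι X : Type*} [Fintype ι] [DecidableEq ι] [MeasurableSpace X]
    (ν : Measure X) [IsProbabilityMeasure ν] (A : Finset ι) :
    MeasurePreserving (fun q : (ι → X) × (ι → X) => A.piecewise q.1 q.2)
      ((Measure.pi fun _ => ν).prod (Measure.pi fun _ => ν)) (Measure.pi fun _ => ν) := by
  have hm : Measurable fun q : (ι → X) × (ι → X) => A.piecewise q.1 q.2 := by
    refine measurable_pi_lambda _ fun i => ?_
    by_cases hi : i ∈ A
    · simp only [Finset.piecewise, hi, if_true]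
      fun_prop
    · simp only [Finset.piecewise, hi, if_false]
      fun_prop
  refine ⟨hm, (Measure.pi_eq fun s hs => ?_).symm⟩
  have : (fun q : (ι → X) × (ι → X) => A.piecewise q.1 q.2) ⁻¹' Set.univ.pi s =
      (Set.univ.pi fun i => if i ∈ A then s i else Set.univ) ×ˢ
        (Set.univ.pi fun i => if i ∈ A then Set.univ else s i) := by
    ext q
    simp only [Set.mem_preimage, Set.mem_pi, Set.mem_prod, Set.mem_univ, true_implies,
      ← forall_and]
    refine forall_congr' fun i => ?_
    by_cases hi : i ∈ A <;> simp [hi]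
  rw [Measure.map_apply hm (MeasurableSet.univ_pi hs), this, Measure.prod_prod, Measure.pi_pi,
    Measure.pi_pi, ← Finset.prod_mul_distrib]
  refine Finset.prod_congr rfl fun i _ => ?_
  by_cases hi : i ∈ A <;> simp [hi]

/-! ### Bipartite sums of a degenerate kernel. -/

section DegenerateKernel

variable {ι X : Type*} [Fintype ι] [DecidableEq ι] [MeasurableSpace X] {ν : Measure X}
  [IsProbabilityMeasure ν] {g : X → X → ℝ}

theorem lintegral_exp_sq_sum_le [Nonempty ι] {φ : X → ℝ} (hm : Measurable φ)
    (hb : ∀ x, |φ x| ≤ 1) (h0 : ∫ x, φ x ∂ν = 0) (A : Finset ι) :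
    ∫⁻ x, ENNReal.ofReal (Real.exp ((∑ i ∈ A, φ (x i)) ^ 2 / (4 * Fintype.card ι)))
      ∂(Measure.pi fun _ : ι => ν) ≤ ENNReal.ofReal expMomentBound := by
  let ψ : ι → X → ℝ := fun i x => if i ∈ A then φ x else 0
  have hψm (i : ι) : Measurable (ψ i) := by
    by_cases hi : i ∈ A <;> simp [ψ, hi, hm]
  have hind : iIndepFun (fun i (x : ι → X) => ψ i (x i)) (Measure.pi fun _ : ι => ν) :=
    iIndepFun_pi fun i => (hψm i).aemeasurable
  have hsub (i : ι) : HasSubgaussianMGF (fun x : ι → X => ψ i (x i)) 1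
      (Measure.pi fun _ : ι => ν) := by
    have := hasSubgaussianMGF_of_mem_Icc_of_integral_eq_zero (μ := Measure.pi fun _ : ι => ν)
      (X := fun x : ι → X => ψ i (x i)) (a := -1) (b := 1)
      ((hψm i).comp (measurable_pi_apply i)).aemeasurable
      (ae_of_all _ fun x => by
        by_cases hi : i ∈ A
        · simpa [ψ, hi] using abs_le.1 (hb (x i))
        · simp [ψ, hi])
      (by
        rw [integral_comp_eval (μ := fun _ : ι => ν) (hψm i).aestronglyMeasurable]
        by_cases hi : i ∈ A <;> simp [ψ, hi, h0])
    -- Hoeffding's proxy for values in [-1, 1] is ((1 - (-1)) / 2)^2 = 1.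
    convert this using 1
    rw [← NNReal.coe_inj]
    norm_num
  have hsum := HasSubgaussianMGF.sum_of_iIndepFun hind (s := Finset.univ) fun i _ => hsub i
  have := hsum.lintegral_exp_sq_le (by simp [Fintype.card_pos])
    (Finset.measurable_sum _ fun i _ => (hψm i).comp (measurable_pi_apply i))
  simpa [ψ, Finset.sum_ite_mem] using this

theorem lintegral_exp_bipartite_le [Nonempty ι] (hg : Measurable (Function.uncurry g))
    (hb : ∀ x y, |g x y| ≤ 1) (hl : ∀ x, ∫ y, g x y ∂ν = 0) (hr : ∀ y, ∫ x, g x y ∂ν = 0)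
    (A : Finset ι) :
    ∫⁻ x, ENNReal.ofReal (Real.exp
      ((∑ i ∈ A, ∑ j ∈ Aᶜ, g (x i) (x j)) / (2 * Fintype.card ι)))
      ∂(Measure.pi fun _ : ι => ν) ≤ ENNReal.ofReal expMomentBound := by
  set N : ℝ := (Fintype.card ι : ℝ) with hN
  have hNpos : 0 < N := by simp [hN, Fintype.card_pos]
  have hN1 : 1 ≤ N := by
    rw [hN]; exact_mod_cast Fintype.card_pos (α := ι)
  let S : (ι → X) → X → ℝ := fun x z => ∑ i ∈ A, g (x i) z
  have hgx (i : ι) : Measurable fun q : (ι → X) × X => g (q.1 i) q.2 :=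
    hg.comp (f := fun q : (ι → X) × X => (q.1 i, q.2))
      (((measurable_pi_apply i).comp measurable_fst).prodMk measurable_snd)
  have hS : Measurable (Function.uncurry S) := Finset.measurable_sum _ fun i _ => hgx i
  have hSx (x : ι → X) : Measurable (S x) := hS.comp measurable_prodMk_left
  have hSb (x : ι → X) (z : X) : |S x z| ≤ N := by
    calc |S x z| ≤ ∑ i ∈ A, |g (x i) z| := Finset.abs_sum_le_sum_abs _ _
      _ ≤ ∑ i ∈ A, 1 := Finset.sum_le_sum fun i _ => hb _ _
      _ ≤ N := by simpa [hN] using Finset.card_le_univ A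
  have hS0 (x : ι → X) : ∫ z, S x z ∂ν = 0 := by
    simp only [S]
    rw [integral_finsetSum]
    · simp [hl]
    · exact fun i _ => Integrable.of_bound (hg.comp measurable_prodMk_left).aestronglyMeasurable 1
        (ae_of_all _ fun z => hb _ _)
  have hSsq (x : ι → X) (z : X) : |S x z ^ 2 / (4 * N)| ≤ N := by
    rw [abs_of_nonneg (by positivity), div_le_iff₀ (by positivity)]
    nlinarith [sq_le_sq' (abs_le.1 (hSb x z)).1 (abs_le.1 (hSb x z)).2]
  let π : Measure (ι → X) := Measure.pi fun _ => ν
  let G : (ι → X) → ENNReal := fun x => ENNReal.ofReal (Real.exp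
      ((∑ i ∈ A, ∑ j ∈ Aᶜ, g (x i) (x j)) / (2 * N)))
  have hG : Measurable G := by
    refine ENNReal.measurable_ofReal.comp (Real.measurable_exp.comp (Measurable.div_const ?_ _))
    exact Finset.measurable_sum _ fun i _ => Finset.measurable_sum _ fun j _ =>
      hg.comp_eval_eval i j
  have inner (x : ι → X) : ∫⁻ y, G (A.piecewise x y) ∂π ≤
      ∫⁻ z, ENNReal.ofReal (Real.exp (S x z ^ 2 / (4 * N))) ∂ν := by
    have hsplit (y : ι → X) : G (A.piecewise x y) =
        ∏ j, ENNReal.ofReal (Real.exp (if j ∈ Aᶜ then S x (y j) / (2 * N) else 0)) := by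
      rw [← ENNReal.ofReal_prod_of_nonneg fun _ _ => (Real.exp_pos _).le, ← Real.exp_sum]
      simp only [G, S]
      congr 2
      rw [Finset.sum_ite_mem, Finset.univ_inter, ← Finset.sum_div, Finset.sum_comm]
      congr 1
      refine Finset.sum_congr rfl fun j hj => Finset.sum_congr rfl fun i hi => ?_
      rw [Finset.piecewise_eq_of_mem _ _ _ hi,
        Finset.piecewise_eq_of_notMem _ _ _ (Finset.mem_compl.1 hj)]
    have hfac (j : ι) : ∫⁻ z, ENNReal.ofReal (Real.exp
        (if j ∈ Aᶜ then S x z / (2 * N) else 0)) ∂ν ≤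
        ENNReal.ofReal (Real.exp (∫ z, S x z ^ 2 / (4 * N ^ 2) ∂ν)) := by
      by_cases hj : j ∈ Aᶜ
      · simp only [hj, if_true]
        refine (lintegral_exp_le_exp_integral_sq ((hSx x).div_const _) (fun z => ?_) ?_).trans_eq ?_
        · rw [abs_div, abs_of_pos (by positivity : 0 < 2 * N), div_le_one (by positivity)]
          linarith [hSb x z]
        · rw [integral_div, hS0, zero_div]
        · simp_rw [div_pow, mul_pow]
          norm_num
      -- Indices in A give the factor 1, which also satisfies the bound; thus all N factors share
      -- one bound and N / (4N^2) becomes 1 / (4N).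
      · simp only [hj, if_false, Real.exp_zero, lintegral_const, measure_univ, mul_one]
        exact ENNReal.ofReal_le_ofReal (Real.one_le_exp (integral_nonneg fun z => by positivity))
    calc ∫⁻ y, G (A.piecewise x y) ∂π
        = ∏ j : ι, ∫⁻ z, ENNReal.ofReal (Real.exp
            (if j ∈ Aᶜ then S x z / (2 * N) else 0)) ∂ν := by
          simp_rw [hsplit]
          exact lintegral_pi_prod_eq_prod (F := fun j z => ENNReal.ofReal (Real.exp
            (if j ∈ Aᶜ then S x z / (2 * N) else 0))) fun j =>
            ENNReal.measurable_ofReal.comp (Real.measurable_exp.comp (by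
              by_cases hj : j ∈ Aᶜ
              · simpa only [hj, if_true] using (hSx x).div_const _
              · simp only [hj, if_false, measurable_const]))
      _ ≤ ∏ _j : ι, ENNReal.ofReal (Real.exp (∫ z, S x z ^ 2 / (4 * N ^ 2) ∂ν)) :=
          Finset.prod_le_prod' fun j _ => hfac j
      _ = ENNReal.ofReal (Real.exp (∫ z, S x z ^ 2 / (4 * N) ∂ν)) := by
          rw [Finset.prod_const, Finset.card_univ, ← ENNReal.ofReal_pow (Real.exp_pos _).le,
            ← Real.exp_nat_mul, ← hN, ← integral_const_mul]
          congr 3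
          ext z
          field_simp
      -- Jensen moves the average over z outside the exponential, so that z can be fixed after
      -- exchanging the integrals.
      _ ≤ _ := ofReal_exp_integral_le_lintegral (((hSx x).pow_const 2).div_const _) (hSsq x)
  calc ∫⁻ x, G x ∂π = ∫⁻ q, G (A.piecewise q.1 q.2) ∂(π.prod π) :=
        ((measurePreserving_piecewise ν A).lintegral_comp hG).symm
    _ = ∫⁻ x, ∫⁻ y, G (A.piecewise x y) ∂π ∂π :=
        lintegral_prod _ (hG.comp (measurePreserving_piecewise ν A).measurable).aemeasurable
    _ ≤ ∫⁻ x, ∫⁻ z, ENNReal.ofReal (Real.exp (S x z ^ 2 / (4 * N))) ∂ν ∂π :=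
        lintegral_mono inner
    _ = ∫⁻ z, ∫⁻ x, ENNReal.ofReal (Real.exp (S x z ^ 2 / (4 * N))) ∂π ∂ν :=
        lintegral_lintegral_swap (ENNReal.measurable_ofReal.comp (Real.measurable_exp.comp
          ((hS.pow_const 2).div_const _))).aemeasurable
    _ ≤ ∫⁻ _z, ENNReal.ofReal expMomentBound ∂ν :=
        lintegral_mono fun z => lintegral_exp_sq_sum_le (φ := fun x => g x z)
          (hg.comp measurable_prodMk_right) (fun x => hb x z) (hr z) A
    _ = _ := by simp

end DegenerateKernel

/-! ### Decoupling by random bipartition, and the tail bound. -/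

/-- A uniformly random A contains i and misses j ≠ i with probability 1/4; such sets form an
interval of size 2^(N-2). -/
theorem sum_powerset_bipartite {ι : Type*} [Fintype ι] [DecidableEq ι] (w : ι → ι → ℝ) :
    4 * ∑ A : Finset ι, ∑ i ∈ A, ∑ j ∈ Aᶜ, w i j =
      2 ^ Fintype.card ι * ∑ i, ∑ j ∈ Finset.univ.erase i, w i j := by
  have hcount (i j : ι) (hij : j ≠ i) :
      4 * (Finset.univ.filter fun A : Finset ι => i ∈ A ∧ j ∉ A).card = 2 ^ Fintype.card ι := by
    have hc : 2 ≤ Fintype.card ι := Fintype.one_lt_card_iff.2 ⟨j, i, hij⟩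
    have : (Finset.univ.filter fun A : Finset ι => i ∈ A ∧ j ∉ A) =
        Finset.Icc {i} (Finset.univ.erase j) := by
      ext A
      simp [Finset.subset_erase]
    rw [this, Finset.card_Icc_finset (by simpa using hij.symm)]
    simp only [Finset.mem_univ, Finset.card_erase_of_mem, Finset.card_univ,
      Finset.card_singleton]
    obtain ⟨m, hm⟩ := Nat.exists_eq_add_of_le hc
    rw [hm, show 2 + m - 1 - 1 = m by omega, pow_add]
    norm_num
  have hrw : ∑ A : Finset ι, ∑ i ∈ A, ∑ j ∈ Aᶜ, w i j =
      ∑ i, ∑ j, (Finset.univ.filter fun A : Finset ι => i ∈ A ∧ j ∉ A).card * w i j := by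
    calc _ = ∑ A : Finset ι, ∑ i, ∑ j, if i ∈ A ∧ j ∉ A then w i j else 0 := by
          refine Finset.sum_congr rfl fun A _ => ?_
          rw [← Finset.sum_ite_mem_eq]
          refine Finset.sum_congr rfl fun i _ => ?_
          by_cases hi : i ∈ A
          · simp only [hi, if_true, true_and]
            rw [← Finset.sum_ite_mem_eq]
            simp
          · simp [hi]
      _ = _ := by
          rw [Finset.sum_comm]
          refine Finset.sum_congr rfl fun i _ => ?_
          rw [Finset.sum_comm]
          refine Finset.sum_congr rfl fun j _ => ?_
          rw [← Finset.sum_filter, Finset.sum_const, nsmul_eq_mul]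
  rw [hrw, Finset.mul_sum, Finset.mul_sum]
  refine Finset.sum_congr rfl fun i _ => ?_
  rw [Finset.mul_sum, Finset.mul_sum, ← Finset.sum_erase Finset.univ (a := i) (by simp)]
  refine Finset.sum_congr rfl fun j hj => ?_
  rw [← mul_assoc]
  congr 1
  exact_mod_cast hcount i j (Finset.ne_of_mem_erase hj)

theorem sum_erase_eq_two_mul_sum_lt {ι : Type*} [Fintype ι] [LinearOrder ι] (w : ι → ι → ℝ)
    (hw : ∀ i j, w i j = w j i) :
    ∑ i, ∑ j ∈ Finset.univ.erase i, w i j =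
      2 * ∑ q : ι × ι with q.1 < q.2, w q.1 q.2 := by
  have h1 : ∑ i, ∑ j ∈ Finset.univ.erase i, w i j =
      ∑ i, ∑ j, ((if i < j then w i j else 0) + if j < i then w j i else 0) := by
    refine Finset.sum_congr rfl fun i _ => ?_
    rw [← Finset.sum_erase Finset.univ (a := i) (by simp)]
    refine Finset.sum_congr rfl fun j hj => ?_
    rcases lt_or_gt_of_ne (Finset.ne_of_mem_erase hj) with h | h
    · simp [h, h.not_gt, hw i j]
    · simp [h, h.not_gt]
  have h2 : ∑ i, ∑ j, (if i < j then w i j else 0) = ∑ q : ι × ι with q.1 < q.2, w q.1 q.2 := by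
    rw [Finset.sum_filter, Fintype.sum_prod_type]
  rw [h1]
  simp_rw [Finset.sum_add_distrib]
  rw [Finset.sum_comm (f := fun i j => if j < i then w j i else 0), h2, two_mul]

/-- The average bipartite sum is 1/4 of the sum over ordered pairs, so 1/2 of that over i < j: the
scale 2N becomes 4N. Convexity of exp passes the bound to the average. -/
theorem lintegral_exp_sum_lt_le {ι X : Type*} [Fintype ι] [LinearOrder ι] [Nonempty ι]
    [MeasurableSpace X] {ν : Measure X} [IsProbabilityMeasure ν] {g : X → X → ℝ}
    (hg : Measurable (Function.uncurry g)) (hb : ∀ x y, |g x y| ≤ 1)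
    (hsymm : ∀ x y, g x y = g y x) (h0 : ∀ x, ∫ y, g x y ∂ν = 0) :
    ∫⁻ x, ENNReal.ofReal (Real.exp
      ((∑ q : ι × ι with q.1 < q.2, g (x q.1) (x q.2)) / (4 * Fintype.card ι)))
      ∂(Measure.pi fun _ : ι => ν) ≤ ENNReal.ofReal expMomentBound := by
  have hN : (0 : ℝ) < Fintype.card ι := by exact_mod_cast Fintype.card_pos (α := ι)
  let T : Finset ι → (ι → X) → ℝ := fun A x =>
    (∑ i ∈ A, ∑ j ∈ Aᶜ, g (x i) (x j)) / (2 * Fintype.card ι)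
  have hT (A : Finset ι) : Measurable (T A) := by
    refine Measurable.div_const (Finset.measurable_sum _ fun i _ => Finset.measurable_sum _
      fun j _ => hg.comp_eval_eval i j) _
  set p : ℝ := (2 ^ Fintype.card ι)⁻¹ with hp
  have hp0 : 0 ≤ p := by positivity
  have hpsum : ∑ _A : Finset ι, p = 1 := by
    simp [hp]
  have havg (x : ι → X) : (∑ q : ι × ι with q.1 < q.2, g (x q.1) (x q.2)) /
      (4 * Fintype.card ι) = ∑ A, p * T A x := by
    have h := sum_powerset_bipartite fun i j => g (x i) (x j)
    rw [sum_erase_eq_two_mul_sum_lt _ fun i j => hsymm _ _] at h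
    rw [← Finset.mul_sum, ← Finset.sum_div, hp]
    field_simp
    linarith
  calc _ ≤ ∫⁻ x, ∑ A, ENNReal.ofReal p * ENNReal.ofReal (Real.exp (T A x))
        ∂(Measure.pi fun _ : ι => ν) := by
        refine lintegral_mono fun x => ?_
        dsimp only
        rw [havg]
        have := convexOn_exp.map_sum_le (t := Finset.univ) (w := fun _ : Finset ι => p)
          (p := fun A => T A x) (fun _ _ => hp0) hpsum fun _ _ => Set.mem_univ _
        simp only [smul_eq_mul] at this
        refine (ENNReal.ofReal_le_ofReal this).trans_eq ?_
        rw [ENNReal.ofReal_sum_of_nonneg fun A _ => by positivity]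
        simp_rw [ENNReal.ofReal_mul hp0]
    _ = ∑ A, ENNReal.ofReal p * ∫⁻ x, ENNReal.ofReal (Real.exp (T A x))
        ∂(Measure.pi fun _ : ι => ν) := by
        have hm (A : Finset ι) : Measurable fun x => ENNReal.ofReal (Real.exp (T A x)) :=
          ENNReal.measurable_ofReal.comp (Real.measurable_exp.comp (hT A))
        rw [lintegral_finsetSum _ fun A _ => (hm A).const_mul _]
        simp_rw [lintegral_const_mul _ (hm _)]
    _ ≤ ∑ _A : Finset ι, ENNReal.ofReal p * ENNReal.ofReal expMomentBound := by
        gcongr with A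
        exact lintegral_exp_bipartite_le hg hb h0
          (fun y => by simpa only [hsymm _ y] using h0 y) A
    _ = _ := by
        rw [← Finset.sum_mul, ← ENNReal.ofReal_sum_of_nonneg fun _ _ => hp0, hpsum]
        simp

/-- A degenerate U-statistic of order two whose symmetric kernel is bounded by one has
exponential tails on the scale of the number of variables. -/
theorem measureReal_abs_sum_lt_gt_le {ι X : Type*} [Fintype ι] [LinearOrder ι] [Nonempty ι]
    [MeasurableSpace X] {ν : Measure X} [IsProbabilityMeasure ν] {g : X → X → ℝ}
    (hg : Measurable (Function.uncurry g)) (hb : ∀ x y, |g x y| ≤ 1)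
    (hsymm : ∀ x y, g x y = g y x) (h0 : ∀ x, ∫ y, g x y ∂ν = 0) (t : ℝ) :
    (Measure.pi fun _ : ι => ν).real
      {x | t * (4 * Fintype.card ι) < |∑ q : ι × ι with q.1 < q.2, g (x q.1) (x q.2)|} ≤
      2 * expMomentBound * Real.exp (-t) := by
  have hN : (0 : ℝ) < 4 * Fintype.card ι := by
    have : (0 : ℝ) < Fintype.card ι := by exact_mod_cast Fintype.card_pos (α := ι)
    positivity
  have key (k : X → X → ℝ) (hk : Measurable (Function.uncurry k)) (hkb : ∀ x y, |k x y| ≤ 1)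
      (hks : ∀ x y, k x y = k y x) (hk0 : ∀ x, ∫ y, k x y ∂ν = 0) :
      (Measure.pi fun _ : ι => ν).real
        {x | t ≤ (∑ q : ι × ι with q.1 < q.2, k (x q.1) (x q.2)) / (4 * Fintype.card ι)} ≤
        expMomentBound * Real.exp (-t) := by
    refine ENNReal.toReal_le_of_le_ofReal
      (mul_nonneg expMomentBound_pos.le (Real.exp_pos _).le) ?_
    have hm : Measurable fun x : ι → X => ENNReal.ofReal (Real.exp
        ((∑ q : ι × ι with q.1 < q.2, k (x q.1) (x q.2)) / (4 * Fintype.card ι))) :=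
      ENNReal.measurable_ofReal.comp (Real.measurable_exp.comp (Measurable.div_const
        (Finset.measurable_sum _ fun q _ => hk.comp_eval_eval q.1 q.2) _))
    calc _ ≤ (Measure.pi fun _ : ι => ν) {x | ENNReal.ofReal (Real.exp t) ≤
          ENNReal.ofReal (Real.exp ((∑ q : ι × ι with q.1 < q.2, k (x q.1) (x q.2)) / (4 * Fintype.card ι)))} :=
          measure_mono fun x hx => ENNReal.ofReal_le_ofReal (Real.exp_le_exp.2 hx)
      _ ≤ _ := meas_ge_le_lintegral_div hm.aemeasurable (by simp [Real.exp_pos])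
          ENNReal.ofReal_ne_top
      _ ≤ ENNReal.ofReal expMomentBound / ENNReal.ofReal (Real.exp t) := by
          gcongr
          exact lintegral_exp_sum_lt_le hk hkb hks hk0
      _ = _ := by
          rw [← ENNReal.ofReal_div_of_pos (Real.exp_pos t), Real.exp_neg, div_eq_mul_inv]
  have hsub : {x : ι → X | t * (4 * Fintype.card ι) <
        |∑ q : ι × ι with q.1 < q.2, g (x q.1) (x q.2)|} ⊆
      {x | t ≤ (∑ q : ι × ι with q.1 < q.2, g (x q.1) (x q.2)) / (4 * Fintype.card ι)} ∪
      {x | t ≤ (∑ q : ι × ι with q.1 < q.2, -g (x q.1) (x q.2)) / (4 * Fintype.card ι)} := by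
    intro x hx
    simp only [Set.mem_union, Set.mem_ofPred_eq, Finset.sum_neg_distrib, le_div_iff₀ hN] at hx ⊢
    exact le_abs.1 hx.le
  calc _ ≤ _ := measureReal_mono hsub
    _ ≤ _ := measureReal_union_le _ _
    _ ≤ expMomentBound * Real.exp (-t) + expMomentBound * Real.exp (-t) :=
        add_le_add (key g hg hb hsymm h0) (key (fun x y => -g x y) hg.neg
          (fun x y => by simpa using hb x y) (fun x y => by rw [hsymm])
          (fun x => by rw [integral_neg, h0, neg_zero]))
    _ = _ := by ring

/-- Distinct coordinates have joint law ν ⊗ ν, so Fubini applies to each term. This identifies the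
centring constant with the mean of f_r. -/
theorem integral_sum_lt_eq_zero {ι X : Type*} [Fintype ι] [LinearOrder ι]
    [MeasurableSpace X] {ν : Measure X} [IsProbabilityMeasure ν] {g : X → X → ℝ}
    (hg : Measurable (Function.uncurry g)) (hb : ∀ x y, |g x y| ≤ 1)
    (h0 : ∀ x, ∫ y, g x y ∂ν = 0) :
    ∫ x, ∑ q : ι × ι with q.1 < q.2, g (x q.1) (x q.2) ∂(Measure.pi fun _ : ι => ν) = 0 := by
  have hm (q : ι × ι) : Measurable fun x : ι → X => (x q.1, x q.2) :=
    (measurable_pi_apply q.1).prodMk (measurable_pi_apply q.2)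
  rw [integral_finsetSum _ fun q _ => Integrable.of_bound
    (hg.comp_eval_eval q.1 q.2).aestronglyMeasurable 1 (ae_of_all _ fun x => hb _ _)]
  refine Finset.sum_eq_zero fun q hq => ?_
  have hind : iIndepFun (fun i (x : ι → X) => x i) (Measure.pi fun _ : ι => ν) :=
    iIndepFun_pi (X := fun _ x => x) fun _ => aemeasurable_id
  have hmap : (Measure.pi fun _ : ι => ν).map (fun x => (x q.1, x q.2)) = ν.prod ν := by
    have hne : q.1 ≠ q.2 := (Finset.mem_filter.1 hq).2.ne
    rw [(hind.indepFun hne).map_prod_eq_prod_map_map (measurable_pi_apply _).aemeasurable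
        (measurable_pi_apply _).aemeasurable]
    congr 1 <;> exact (measurePreserving_eval (fun _ : ι => ν) _).map_eq
  calc _ = ∫ z, Function.uncurry g z ∂(ν.prod ν) := by
        rw [← hmap, integral_map (hm q).aemeasurable hg.aestronglyMeasurable]
        rfl
    _ = 0 := by
        rw [integral_prod _ (Integrable.of_bound hg.aestronglyMeasurable 1
          (ae_of_all _ fun z => hb _ _))]
        simp [h0]

/-! ### From the cube to the torus. -/

instance isProbabilityMeasure_volume_unitAddCircle :
    IsProbabilityMeasure (volume : Measure UnitAddCircle) :=
  ⟨by rw [AddCircle.measure_univ, ENNReal.ofReal_one]⟩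

instance isProbabilityMeasure_volume_torus (d : ℕ) :
    IsProbabilityMeasure (volume : Measure (Fin d → UnitAddCircle)) :=
  inferInstanceAs (IsProbabilityMeasure (Measure.pi fun _ => volume))

theorem toroidalAbs_sub_eq_norm {x y : ℝ} (hx : x ∈ Set.Icc (0 : ℝ) 1)
    (hy : y ∈ Set.Icc (0 : ℝ) 1) :
    toroidalAbs (x - y) = ‖(x : UnitAddCircle) - (y : UnitAddCircle)‖ := by
  have key (t : ℝ) (h0 : 0 ≤ t) (h1 : t ≤ 1) : toroidalAbs t = ‖(t : UnitAddCircle)‖ := by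
    rw [UnitAddCircle.norm_eq, abs_sub_round_eq_min, toroidalAbs, abs_of_nonneg h0]
    -- The endpoint t = 1 has fractional part 0, but both sides still vanish.
    rcases h1.eq_or_lt with rfl | h
    · simp
    · rw [Int.fract_eq_self.2 ⟨h0, h⟩]
  have hneg (t : ℝ) : toroidalAbs (-t) = toroidalAbs t := by simp [toroidalAbs]
  rcases le_total y x with h | h
  · rw [key _ (sub_nonneg.2 h) (by linarith [hx.2, hy.1]), AddCircle.coe_sub]
  · rw [← hneg, neg_sub, key _ (sub_nonneg.2 h) (by linarith [hy.2, hx.1]), AddCircle.coe_sub,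
      norm_sub_rev]

/-- The Euclidean length of a vector of points of the unit circle. -/
noncomputable def torusLength {d : ℕ} (w : Fin d → UnitAddCircle) : ℝ := √(∑ l, ‖w l‖ ^ 2)

theorem measurable_torusLength {d : ℕ} :
    Measurable (torusLength : (Fin d → UnitAddCircle) → ℝ) := by
  have : Continuous (torusLength : (Fin d → UnitAddCircle) → ℝ) := by
    unfold torusLength
    fun_prop
  exact this.measurable

theorem torusLength_sub_comm {d : ℕ} (u v : Fin d → UnitAddCircle) :
    torusLength (u - v) = torusLength (v - u) := by
  simp only [torusLength, Pi.sub_apply, norm_sub_rev]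

theorem toroidalDist_eq_torusLength {d : ℕ} {x y : Fin d → ℝ}
    (hx : x ∈ Set.Icc (0 : Fin d → ℝ) 1) (hy : y ∈ Set.Icc (0 : Fin d → ℝ) 1) :
    toroidalDist x y =
      torusLength ((fun l => (x l : UnitAddCircle)) - fun l => (y l : UnitAddCircle)) := by
  simp only [toroidalDist, torusLength, Pi.sub_apply]
  congr 1
  refine Finset.sum_congr rfl fun l _ => ?_
  rw [toroidalAbs_sub_eq_norm ⟨hx.1 l, hx.2 l⟩ ⟨hy.1 l, hy.2 l⟩]

theorem measurePreserving_unitCube_mk (d : ℕ) :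
    MeasurePreserving (fun (x : Fin d → ℝ) l => (x l : UnitAddCircle))
      (volume.restrict (Set.Icc (0 : Fin d → ℝ) 1)) volume := by
  have h1 : MeasurePreserving (fun x : ℝ => (x : UnitAddCircle))
      (volume.restrict (Set.Icc (0 : ℝ) 1)) volume := by
    have := UnitAddCircle.measurePreserving_mk 0
    rwa [zero_add, restrict_Ioc_eq_restrict_Icc] at this
  have h2 := measurePreserving_pi (fun _ : Fin d => volume.restrict (Set.Icc (0 : ℝ) 1))
    (fun _ => (volume : Measure UnitAddCircle)) fun _ => h1
  rwa [← Measure.restrict_pi_pi, Set.pi_univ_Icc] at h2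

open Classical in
/-- The indicator of the closed ball of radius `r` around the origin of the torus. -/
noncomputable def torusBallIndicator {d : ℕ} (r : ℝ) (w : Fin d → UnitAddCircle) : ℝ :=
  if torusLength w ≤ r then 1 else 0

/-- The centred indicator that two points of the torus are at distance at most `r`. -/
noncomputable def closeKernel {d : ℕ} (r : ℝ) (u v : Fin d → UnitAddCircle) : ℝ :=
  torusBallIndicator r (u - v) - ∫ w : Fin d → UnitAddCircle, torusBallIndicator r w

section CloseKernel

variable {d : ℕ} (r : ℝ)

theorem measurable_torusBallIndicator :
    Measurable (torusBallIndicator (d := d) r) :=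
  Measurable.ite (measurableSet_le measurable_torusLength measurable_const)
    measurable_const measurable_const

theorem torusBallIndicator_mem_Icc (w : Fin d → UnitAddCircle) :
    torusBallIndicator r w ∈ Set.Icc (0 : ℝ) 1 := by
  unfold torusBallIndicator
  split_ifs <;> simp

theorem integrable_torusBallIndicator : Integrable (torusBallIndicator (d := d) r) volume :=
  Integrable.of_mem_Icc 0 1 (measurable_torusBallIndicator r).aemeasurable
    (ae_of_all _ (torusBallIndicator_mem_Icc r))

theorem measurable_closeKernel :
    Measurable (Function.uncurry (closeKernel (d := d) r)) :=
  ((measurable_torusBallIndicator r).comp (measurable_fst.sub measurable_snd)).sub_const _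

theorem closeKernel_comm (u v : Fin d → UnitAddCircle) :
    closeKernel r u v = closeKernel r v u := by
  simp only [closeKernel, torusBallIndicator, torusLength_sub_comm u v]

theorem abs_closeKernel_le_one (u v : Fin d → UnitAddCircle) : |closeKernel r u v| ≤ 1 := by
  have h1 : 0 ≤ ∫ w : Fin d → UnitAddCircle, torusBallIndicator r w :=
    integral_nonneg fun w => (torusBallIndicator_mem_Icc r w).1
  have h2 : ∫ w : Fin d → UnitAddCircle, torusBallIndicator r w ≤ 1 := by
    simpa using integral_mono (integrable_torusBallIndicator (d := d) r)
      (integrable_const (1 : ℝ)) fun w => (torusBallIndicator_mem_Icc r w).2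
  have := torusBallIndicator_mem_Icc r (u - v)
  rw [closeKernel, abs_le]
  constructor <;> linarith [this.1, this.2]

/-- Degeneracy of the kernel: Haar measure is translation invariant, so the volume of a ball does
not depend on its centre. -/
theorem integral_closeKernel (u : Fin d → UnitAddCircle) : ∫ v, closeKernel r u v = 0 := by
  simp_rw [closeKernel_comm r u, closeKernel]
  rw [integral_sub ((integrable_torusBallIndicator r).comp_sub_right u) (integrable_const _),
    integral_sub_right_eq_self]
  simp

theorem closePairs_eq_sum {n : ℕ} {p : Fin n → Fin d → ℝ}
    (hp : ∀ i, p i ∈ Set.Icc (0 : Fin d → ℝ) 1) :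
    (closePairs r p : ℝ) = ∑ q : Fin n × Fin n with q.1 < q.2,
        closeKernel r (fun l => (p q.1 l : UnitAddCircle)) (fun l => (p q.2 l : UnitAddCircle)) +
      (Finset.univ.filter fun q : Fin n × Fin n => q.1 < q.2).card *
        ∫ w : Fin d → UnitAddCircle, torusBallIndicator r w := by
  classical
  simp only [closeKernel, Finset.sum_sub_distrib, Finset.sum_const, nsmul_eq_mul,
    sub_add_cancel, torusBallIndicator]
  rw [closePairs, Finset.sum_boole, Finset.filter_filter]
  congr 2
  ext q
  simp [toroidalDist_eq_torusLength (hp q.1) (hp q.2)]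

end CloseKernel

/-! ### Choice of the constant and conclusion. -/

theorem exists_forall_bound_mul_exp_le (a : ℝ) (ha : 0 < a) {C : ℝ} (hC : 1 ≤ C) :
    ∃ c₀ : ℝ, 0 < c₀ ∧ ∀ c, c₀ ≤ c → ∀ n : ℕ, 2 ≤ n →
      C * Real.exp (-(c * Real.log n / 4)) ≤ 1 / (n : ℝ) ^ a := by
  have hl2 : 0 < Real.log 2 := Real.log_pos (by norm_num)
  have hlC : 0 ≤ Real.log C := Real.log_nonneg hC
  -- The summand a yields n^(-a); the other absorbs C, since log n ≥ log 2.
  refine ⟨4 * (a + Real.log C / Real.log 2), by positivity, fun c hc n hn => ?_⟩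
  have hn0 : (0 : ℝ) < n := by positivity
  have hln : Real.log 2 ≤ Real.log n := Real.log_le_log (by norm_num) (by exact_mod_cast hn)
  rw [one_div, ← Real.rpow_neg hn0.le, Real.rpow_def_of_pos hn0]
  nth_rw 1 [← Real.exp_log (zero_lt_one.trans_le hC)]
  rw [← Real.exp_add, Real.exp_le_exp]
  have h1 : Real.log C ≤ Real.log C / Real.log 2 * Real.log n := by
    rw [div_mul_eq_mul_div, le_div_iff₀ hl2]
    gcongr
  have h2 : 4 * (a + Real.log C / Real.log 2) * Real.log n ≤ c * Real.log n := by
    gcongr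
  linarith

theorem one_le_two_mul_expMomentBound : 1 ≤ 2 * expMomentBound := by
  have h1 : Real.exp (-1) < 1 := by simp
  have h2 : 1 ≤ (1 - Real.exp (-1))⁻¹ :=
    (one_le_inv₀ (by linarith)).2 (by linarith [Real.exp_pos (-1)])
  have h3 : 1 ≤ Real.exp 1 := Real.one_le_exp zero_le_one
  unfold expMomentBound
  nlinarith

theorem measureReal_closePairs_deviation_le {d n : ℕ} (hn : 1 ≤ n) (r : ℝ) {Ω : Type*}
    [MeasurableSpace Ω] {μ : Measure Ω} [IsProbabilityMeasure μ] {p : Fin n → Ω → (Fin d → ℝ)}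
    (hp : ∀ i, Measurable (p i)) (hind : iIndepFun p μ)
    (hu : ∀ i, pdf.IsUniform (p i) (Set.Icc (0 : Fin d → ℝ) 1) μ volume)
    {f : Ω → ℝ} (hf : ∀ ω, f ω = (closePairs r (fun i => p i ω) : ℝ)) (t : ℝ) :
    μ.real {ω | t * (4 * n) < |f ω - ∫ ω', f ω' ∂μ|} ≤
      2 * expMomentBound * Real.exp (-t) := by
  have : Nonempty (Fin n) := ⟨⟨0, hn⟩⟩
  have hvol : volume (Set.Icc (0 : Fin d → ℝ) 1) = 1 := by simp [Real.volume_Icc_pi]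
  let mk : (Fin d → ℝ) → (Fin d → UnitAddCircle) := fun x l => (x l : UnitAddCircle)
  have hmk : Measurable mk := (measurePreserving_unitCube_mk d).measurable
  have hlaw (i : Fin n) : μ.map (p i) = volume.restrict (Set.Icc (0 : Fin d → ℝ) 1) := by
    have := hu i
    rw [pdf.IsUniform, ProbabilityTheory.cond, hvol, inv_one, one_smul] at this
    exact this
  have hUm (i : Fin n) : Measurable fun ω => mk (p i ω) := hmk.comp (hp i)
  have hU (i : Fin n) : μ.map (fun ω => mk (p i ω)) = volume := by
    rw [← (measurePreserving_unitCube_mk d).map_eq, ← hlaw i, Measure.map_map hmk (hp i)]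
    rfl
  have hmp : MeasurePreserving (fun ω i => mk (p i ω)) μ
      (Measure.pi fun _ : Fin n => (volume : Measure (Fin d → UnitAddCircle))) := by
    refine ⟨measurable_pi_lambda _ hUm, ?_⟩
    rw [(hind.comp (fun _ => mk) fun _ => hmk).map_fun_eq_pi_map fun i => (hUm i).aemeasurable]
    congr 1
    exact funext hU
  let F : (Fin n → Fin d → UnitAddCircle) → ℝ := fun x =>
    ∑ q : Fin n × Fin n with q.1 < q.2, closeKernel r (x q.1) (x q.2)
  have hF : Measurable F := Finset.measurable_sum _ fun q _ =>
    (measurable_closeKernel r).comp_eval_eval q.1 q.2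
  -- Only almost everywhere: the two distances are compared only inside the cube.
  obtain ⟨m, hm⟩ : ∃ m : ℝ, ∀ᵐ ω ∂μ, f ω = F (fun i => mk (p i ω)) + m := by
    refine ⟨(Finset.univ.filter fun q : Fin n × Fin n => q.1 < q.2).card *
      ∫ w : Fin d → UnitAddCircle, torusBallIndicator r w, ?_⟩
    have hcube : ∀ᵐ ω ∂μ, ∀ i, p i ω ∈ Set.Icc (0 : Fin d → ℝ) 1 := by
      refine ae_all_iff.2 fun i => ?_
      refine ae_of_ae_map (hp i).aemeasurable (p := fun x => x ∈ Set.Icc (0 : Fin d → ℝ) 1) ?_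
      rw [hlaw i]
      exact ae_restrict_mem measurableSet_Icc
    filter_upwards [hcube] with ω hω
    rw [hf, closePairs_eq_sum r hω]
  have hFi : Integrable (fun ω => F fun i => mk (p i ω)) μ := by
    refine Integrable.of_bound (hF.comp hmp.measurable).aestronglyMeasurable
      (∑ q : Fin n × Fin n with q.1 < q.2, (1 : ℝ)) (ae_of_all _ fun ω => ?_)
    exact (norm_sum_le _ _).trans (Finset.sum_le_sum fun q _ => abs_closeKernel_le_one r _ _)
  have hmean : ∫ ω, f ω ∂μ = m := by
    rw [integral_congr_ae hm, integral_add hFi (integrable_const m)]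
    have := integral_sum_lt_eq_zero (ι := Fin n) (measurable_closeKernel (d := d) r)
      (abs_closeKernel_le_one r) (integral_closeKernel r)
    rw [← hmp.map_eq, integral_map hmp.measurable.aemeasurable hF.aestronglyMeasurable] at this
    simp only [F, this]
    simp
  calc μ.real {ω | t * (4 * n) < |f ω - ∫ ω', f ω' ∂μ|}
      = μ.real ((fun ω i => mk (p i ω)) ⁻¹' {x | t * (4 * n) < |F x|}) := by
        refine measureReal_congr ?_
        filter_upwards [hm] with ω hω
        refine propext ?_
        change t * (4 * n) < |f ω - ∫ ω', f ω' ∂μ| ↔ t * (4 * n) < |F fun i => mk (p i ω)|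
        rw [hmean, hω, add_sub_cancel_right]
    _ = (Measure.pi fun _ : Fin n => (volume : Measure (Fin d → UnitAddCircle))).real
          {x | t * (4 * n) < |F x|} :=
        hmp.measureReal_preimage (measurableSet_lt measurable_const hF.abs).nullMeasurableSet
    _ ≤ _ := by
        have := measureReal_abs_sum_lt_gt_le (ι := Fin n) (measurable_closeKernel (d := d) r)
          (abs_closeKernel_le_one r) (closeKernel_comm r) (integral_closeKernel r) t
        simpa only [Fintype.card_fin] using this

theorem mainTheorem1 (d : ℕ) (hd : 1 ≤ d) (a : ℝ) (ha : 0 < a) :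
    ∃ c₀ : ℝ, 0 < c₀ ∧ ∀ c' : ℝ, c₀ ≤ c' →
      ∀ (n : ℕ), 1 ≤ n → ∀ r ∈ Set.Icc (0 : ℝ) 1,
      ∀ (Ω : Type*) [MeasurableSpace Ω] (μ : Measure Ω) [IsProbabilityMeasure μ]
        (p : Fin n → Ω → (Fin d → ℝ)),
        (∀ i, Measurable (p i)) →
        iIndepFun p μ →
        (∀ i, pdf.IsUniform (p i) (Set.Icc (0 : Fin d → ℝ) 1) μ volume) →
        ∀ f : Ω → ℝ, (∀ ω, f ω = (closePairs r (fun i => p i ω) : ℝ)) →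
        μ.real {ω | |f ω - ∫ ω', f ω' ∂μ| > c' * (n * Real.log n)} ≤ 1 / (n : ℝ) ^ a ∧
        μ.real {ω | f ω ∈ Set.Icc ((∫ ω', f ω' ∂μ) - c' * (n * Real.log n))
            ((∫ ω', f ω' ∂μ) + c' * (n * Real.log n))} ≥ 1 - 1 / (n : ℝ) ^ a := by
  obtain ⟨c₀, hc₀, hc⟩ := exists_forall_bound_mul_exp_le a ha one_le_two_mul_expMomentBound
  refine ⟨c₀, hc₀, fun c' hc' n hn r _ Ω _ μ _ p hp hind hu f hf => ?_⟩
  have h1 : μ.real {ω | |f ω - ∫ ω', f ω' ∂μ| > c' * (n * Real.log n)} ≤ 1 / (n : ℝ) ^ a := by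
    rcases hn.eq_or_lt with rfl | hn2
    -- For n = 1 the right-hand side is 1.
    · simp
    · refine le_trans ?_ (hc c' hc' n hn2)
      have h := measureReal_closePairs_deviation_le hn r hp hind hu hf (c' * Real.log n / 4)
      rwa [show c' * Real.log n / 4 * (4 * n) = c' * (n * Real.log n) by ring] at h
  refine ⟨h1, ?_⟩
  have hcover : (Set.univ : Set Ω) ⊆ {ω | |f ω - ∫ ω', f ω' ∂μ| > c' * (n * Real.log n)} ∪
      {ω | f ω ∈ Set.Icc ((∫ ω', f ω' ∂μ) - c' * (n * Real.log n))
        ((∫ ω', f ω' ∂μ) + c' * (n * Real.log n))} := by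
    intro ω _
    rcases lt_or_ge (c' * (n * Real.log n)) |f ω - ∫ ω', f ω' ∂μ| with h | h
    · exact Or.inl h
    · right
      rw [abs_le] at h
      exact ⟨by linarith [h.1], by linarith [h.2]⟩
  have h2 := (measureReal_mono (μ := μ) hcover).trans (measureReal_union_le _ _)
  rw [probReal_univ] at h2
  linarith
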